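/- Let $p$ be an odd prime and let $\alpha\in\mathbb Z_p^\times$. For $x\in\mathbb Z_p$ let $\langle x\rangle_p\in\{0,1,\dots,p-1\}$ denote the least nonnegative residue of $x$ modulo $p$, and put $\alpha_p^*=(\alpha+\langle-\alpha\rangle_p)/p\in\mathbb Z_p$. Let $\Gamma_p$ be Morita's $p$-adic Gamma function, i.e. the continuous function on $\mathbb Z_p$ with $\Gamma_p(n)=(-1)^n\prod_{1\le k<n,\ p\nmid k}k$ for all integers $n\ge 0$. Let $(x)_k=x(x+1)\cdots(x+k-1)$ and $$F_p(\alpha)={}_5F_4\left[\begin{matrix}\alpha&1+\frac{\alpha}2&\alpha&\alpha&\alpha\\&\frac{\alpha}2&1&1&1\end{matrix}\,\bigg|\,1\right]_{p-1}=\sum_{k=0}^{p-1}\frac{(1+\frac{\alpha}{2})_k}{(\frac{\alpha}{2})_k}\cdot\frac{(\alpha)_k^4}{(k!)^4},$$ where the quotient $(1+\frac{\alpha}{2})_k/(\frac{\alpha}{2})_k$ is read as its continuous extension $(\alpha+2k)/\alpha$ if $\alpha$ is a negative even integer with $(\frac{\alpha}{2})_k=0$. (1) If $\langle-\alpha\rangle_p\geq(p+1)/2$,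 then $$F_p(\alpha)\equiv -p^2\alpha_p^*(1-2\alpha_p^*)\cdot\frac{\Gamma_p(1-2\alpha)}{\Gamma_p(1+\alpha)\Gamma_p(1-\alpha)^3}\pmod{p^4}.$$ (2) If $p\geq 5$ and $\langle-\alpha\rangle_p\leq(p-1)/2$, then $$F_p(\alpha)\equiv -p\alpha_p^*\cdot\frac{\Gamma_p(1-2\alpha)}{\Gamma_p(1+\alpha)\Gamma_p(1-\alpha)^3}\pmod{p^4}.$$ -/

import Mathlib

open Filter Topology

/-- The truncated hypergeometric series
`∑_{k=0}^{n} (a₀)_k ⋯ (a_r)_k / ((b₁)_k ⋯ (b_r)_k) · z ^ k / k!`. -/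
noncomputable def truncHyp {K : Type*} [Field K] {r : ℕ} (a : Fin (r + 1) → K) (b : Fin r → K)
    (z : K) (n : ℕ) : K :=
  ∑ k ∈ Finset.range (n + 1),
    (∏ i, (ascPochhammer K k).eval (a i)) / (∏ i, (ascPochhammer K k).eval (b i)) *
      (z ^ k / (k.factorial : K))

/-- The values `Γ_p(n) = (-1)^n ∏_{1 ≤ k < n, p ∤ k} k` of Morita's Gamma function on `ℕ`
(in particular `Γ_p(0) = 1`). -/
def padicGammaNat (p n : ℕ) : ℤ :=
  (-1) ^ n * ∏ k ∈ (Finset.Ico 1 n).filter (fun k => ¬ p ∣ k), (k : ℤ)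

/-- Morita's `p`-adic Gamma function: `Γ_p(x)` is the limit of `Γ_p(n)` as the natural number `n`
tends to `x` in the `p`-adic norm. -/
noncomputable def padicGamma (p : ℕ) [Fact p.Prime] (x : ℤ_[p]) : ℤ_[p] :=
  limUnder (comap (fun n : ℕ => (n : ℤ_[p])) (𝓝 x)) (fun n : ℕ => ((padicGammaNat p n : ℤ) : ℤ_[p]))

/-- `α* = (α + ⟨-α⟩_p) / p`, where `⟨x⟩_p = x.zmodRepr` is the least nonnegative residue of `x`
modulo `p`. -/
noncomputable def padicDash (p : ℕ) [Fact p.Prime] (α : ℤ_[p]) : ℚ_[p] :=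
  ((α : ℚ_[p]) + ((-α).zmodRepr : ℚ_[p])) / (p : ℚ_[p])

/-- The congruence `x ≡ y (mod p^n)` in `ℚ_p`, that is `x - y ∈ p^n ℤ_p`. -/
def PadicCongr (p : ℕ) [Fact p.Prime] (n : ℕ) (x y : ℚ_[p]) : Prop :=
  ∃ z : ℤ_[p], x - y = (p : ℚ_[p]) ^ n * (z : ℚ_[p])

/-- The truncated well-poised series `₅F₄[α, 1 + α/2, α, α, α; α/2, 1, 1, 1 | 1]_n`. When
`α ∈ {-2, -4, …}` some quotients `(1 + α/2)_k / (α/2)_k` have the form `0 / 0`; the singularity is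
removable, and the value there is the limit from nearby parameters. Where no lower parameter
vanishes this is the literal series (`wellPoised5F4_eq_truncHyp`), and in all cases it is obtained
by cancelling the common factors (`wellPoised5F4_eq_sum`). -/
noncomputable def wellPoised5F4 (p : ℕ) [Fact p.Prime] (α : ℚ_[p]) (n : ℕ) : ℚ_[p] :=
  limUnder (𝓝[≠] α)
    (fun x => truncHyp ![x, 1 + x / 2, x, x, x] ![x / 2, 1, 1, 1] 1 n)

theorem truncHyp_wellPoised (p : ℕ) [Fact p.Prime] (x : ℚ_[p]) (n : ℕ)
    (h : ∀ j < n, x / 2 + (j : ℚ_[p]) ≠ 0) (h0 : x ≠ 0) :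
    truncHyp ![x, 1 + x / 2, x, x, x] ![x / 2, 1, 1, 1] 1 n =
      ∑ k ∈ Finset.range (n + 1), (x + 2 * (k : ℚ_[p])) / x *
        ((ascPochhammer ℚ_[p] k).eval x / (k.factorial : ℚ_[p])) ^ 4 := by
  have key : ∀ k : ℕ, (ascPochhammer ℚ_[p] k).eval (1 + x / 2) * (x / 2) =
      (ascPochhammer ℚ_[p] k).eval (x / 2) * (x / 2 + k) := by
    intro k
    rw [← ascPochhammer_succ_eval, ascPochhammer_succ_left]
    simp [Polynomial.eval_comp, add_comm, mul_comm]
  have nz : ∀ k ≤ n, (ascPochhammer ℚ_[p] k).eval (x / 2) ≠ 0 := by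
    intro k
    induction k with
    | zero => simp
    | succ k ih =>
      intro hk
      rw [ascPochhammer_succ_eval]
      exact mul_ne_zero (ih (by omega)) (h k (by omega))
  unfold truncHyp
  refine Finset.sum_congr rfl fun k hk => ?_
  have hk' := nz k (by simpa [Nat.lt_succ_iff] using hk)
  have hf : (k.factorial : ℚ_[p]) ≠ 0 := by exact_mod_cast k.factorial_ne_zero
  have e1 : (ascPochhammer ℚ_[p] k).eval (1 : ℚ_[p]) = k.factorial := by simp
  have h2 : (ascPochhammer ℚ_[p] k).eval (1 + x / 2) =
      (ascPochhammer ℚ_[p] k).eval (x / 2) * ((x + 2 * k) / x) := by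
    have := key k
    field_simp at this ⊢
    linear_combination this
  have hu : ∏ i, (ascPochhammer ℚ_[p] k).eval ((![x, 1 + x / 2, x, x, x] : Fin 5 → ℚ_[p]) i) =
      (ascPochhammer ℚ_[p] k).eval x * (ascPochhammer ℚ_[p] k).eval (1 + x / 2) *
        (ascPochhammer ℚ_[p] k).eval x * (ascPochhammer ℚ_[p] k).eval x *
        (ascPochhammer ℚ_[p] k).eval x := by
    rw [Fin.prod_univ_five]
    rfl
  rw [hu, h2]
  simp only [Fin.prod_univ_four, Matrix.cons_val, e1, one_pow]
  field_simp

theorem tendsto_truncHyp_wellPoised (p : ℕ) [Fact p.Prime] (α : ℚ_[p]) (n : ℕ) (h0 : α ≠ 0) :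
    Tendsto (fun x : ℚ_[p] => truncHyp ![x, 1 + x / 2, x, x, x] ![x / 2, 1, 1, 1] 1 n) (𝓝[≠] α)
      (𝓝 (∑ k ∈ Finset.range (n + 1), (α + 2 * (k : ℚ_[p])) / α *
        ((ascPochhammer ℚ_[p] k).eval α / (k.factorial : ℚ_[p])) ^ 4)) := by
  have hc : Tendsto (fun x : ℚ_[p] => ∑ k ∈ Finset.range (n + 1), (x + 2 * (k : ℚ_[p])) / x *
        ((ascPochhammer ℚ_[p] k).eval x / (k.factorial : ℚ_[p])) ^ 4) (𝓝[≠] α)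
      (𝓝 (∑ k ∈ Finset.range (n + 1), (α + 2 * (k : ℚ_[p])) / α *
        ((ascPochhammer ℚ_[p] k).eval α / (k.factorial : ℚ_[p])) ^ 4)) := by
    refine Tendsto.mono_left ?_ nhdsWithin_le_nhds
    refine tendsto_finsetSum _ fun k _ => ?_
    refine Tendsto.mul (Tendsto.div (tendsto_id.add_const _) tendsto_id h0) ?_
    exact (((ascPochhammer ℚ_[p] k).continuous.tendsto α).div_const _).pow 4
  refine hc.congr' ?_
  have h1 : ∀ᶠ x in 𝓝[≠] α, ∀ j ∈ Finset.range n, x / 2 + (j : ℚ_[p]) ≠ 0 := by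
    rw [Filter.eventually_all_finset]
    intro j _
    have hj : ∀ᶠ x in 𝓝[≠] α, x ≠ -2 * (j : ℚ_[p]) := by
      by_cases hα : α = -2 * (j : ℚ_[p])
      · rw [← hα]
        exact eventually_mem_nhdsWithin
      · exact nhdsWithin_le_nhds (isOpen_ne.mem_nhds hα)
    filter_upwards [hj] with x hx hx'
    apply hx
    linear_combination 2 * hx'
  have h2 : ∀ᶠ x in 𝓝[≠] α, x ≠ 0 := nhdsWithin_le_nhds (isOpen_ne.mem_nhds h0)
  filter_upwards [h1, h2] with x hx hx0
  exact (truncHyp_wellPoised p x n (fun j hj => hx j (Finset.mem_range.2 hj)) hx0).symm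

theorem wellPoised5F4_eq_sum (p : ℕ) [Fact p.Prime] (α : ℚ_[p]) (n : ℕ) (h0 : α ≠ 0) :
    wellPoised5F4 p α n =
      ∑ k ∈ Finset.range (n + 1), (α + 2 * (k : ℚ_[p])) / α *
        ((ascPochhammer ℚ_[p] k).eval α / (k.factorial : ℚ_[p])) ^ 4 :=
  (tendsto_truncHyp_wellPoised p α n h0).limUnder_eq

theorem wellPoised5F4_eq_truncHyp (p : ℕ) [Fact p.Prime] (α : ℚ_[p]) (n : ℕ) (h0 : α ≠ 0)
    (h : ∀ j < n, α / 2 + (j : ℚ_[p]) ≠ 0) :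
    wellPoised5F4 p α n = truncHyp ![α, 1 + α / 2, α, α, α] ![α / 2, 1, 1, 1] 1 n := by
  rw [wellPoised5F4_eq_sum p α n h0, truncHyp_wellPoised p α n h h0]

/-! Put `a = ⟨-α⟩_p`, `s = α + a = p α*`, `x_k = (α)_k / k!` and `y_k = (-a)_k / (1 + s)_k`, and
write `x⁴ = x (x - y)³ + 3 x³ y - 3 x² y² + x y³`. Summed against `α + 2k`, the first term vanishes
modulo `s⁴`, by pairing `k` with `a - k`. Each of the other three gives a terminating very
well-poised `₅F₄`, which has a closed form as a quotient of Pochhammer symbols. The resulting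
combination of three products is a second-order Taylor interpolation in `s` and collapses, modulo
`s⁴`, to a single quotient. The functional equation of `Γ_p` turns that quotient into values of
`Γ_p`, and a congruence of Wolstenholme type makes `Γ_p` multiplicative on `p ℤ_p` modulo `p³`
(modulo `p²` if `p = 3`), so that `Γ_p(-2s) ≡ Γ_p(s) Γ_p(-s)³`. -/

section Pochhammer

open Polynomial

theorem eval_eq_coeff_zero_add_mul_eval_divX {R : Type*} [CommSemiring R] (P : R[X]) (x : R) :
    P.eval x = P.coeff 0 + x * P.divX.eval x := by
  conv_lhs => rw [← X_mul_divX_add P, eval_add, eval_mul, eval_X, eval_C, add_comm]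

theorem ascPochhammer_succ_eval_left {R : Type*} [CommSemiring R] (k : ℕ) (x : R) :
    (ascPochhammer R (k + 1)).eval x = x * (ascPochhammer R k).eval (x + 1) := by
  simp [ascPochhammer_succ_left, eval_comp]

theorem ascPochhammer_eval_eq_prod {R : Type*} [CommSemiring R] (k : ℕ) (x : R) :
    (ascPochhammer R k).eval x = ∏ i ∈ Finset.range k, (x + i) := by
  induction k with
  | zero => simp
  | succ k ih => rw [ascPochhammer_succ_eval, Finset.prod_range_succ, ih]

theorem mul_ascPochhammer_eval_add_one {R : Type*} [CommSemiring R] (k : ℕ) (x : R) :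
    x * (ascPochhammer R k).eval (x + 1) = (ascPochhammer R k).eval x * (x + k) := by
  rw [← ascPochhammer_succ_eval_left, ascPochhammer_succ_eval]

theorem ascPochhammer_eval_ne_zero {R : Type*} [CommRing R] [IsDomain R] {k : ℕ} {x : R}
    (h : ∀ i < k, x + i ≠ 0) : (ascPochhammer R k).eval x ≠ 0 := by
  rw [ascPochhammer_eval_eq_prod, Finset.prod_ne_zero_iff]
  exact fun i hi => h i (Finset.mem_range.1 hi)

theorem ascPochhammer_add_eval {R : Type*} [CommSemiring R] (m n : ℕ) (x : R) :
    (ascPochhammer R (m + n)).eval x =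
      (ascPochhammer R m).eval x * (ascPochhammer R n).eval (x + m) := by
  simp [← ascPochhammer_mul, eval_comp]

theorem ascPochhammer_eval_neg {R : Type*} [CommRing R] (k : ℕ) (x : R) :
    (ascPochhammer R k).eval (-x) = (-1) ^ k * (ascPochhammer R k).eval (x - k + 1) := by
  rw [ascPochhammer_eval_neg_eq_descPochhammer, descPochhammer_eval_eq_ascPochhammer]

theorem ascPochhammer_eval_neg_natCast_self {R : Type*} [CommRing R] (n : ℕ) :
    (ascPochhammer R n).eval (-(n : R)) = (-1) ^ n * n.factorial := by
  rw [ascPochhammer_eval_neg_eq_descPochhammer, descPochhammer_eval_eq_descFactorial,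
    Nat.descFactorial_self]

theorem ascPochhammer_zmod_prime (p : ℕ) [Fact p.Prime] :
    ascPochhammer (ZMod p) p = X ^ p - X := by
  have hp : 1 < p := (Fact.out : p.Prime).one_lt
  have h_monic : (X ^ p - X : (ZMod p)[X]).Monic :=
    monic_X_pow_sub (degree_X_le.trans_lt (by exact_mod_cast hp))
  have h_deg : (ascPochhammer (ZMod p) p).degree = (X ^ p - X : (ZMod p)[X]).degree := by
    rw [degree_eq_natDegree (monic_ascPochhammer _ _).ne_zero, degree_eq_natDegree h_monic.ne_zero,
      ascPochhammer_natDegree, FiniteField.X_pow_card_sub_X_natDegree_eq _ hp]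
  refine eq_of_degree_sub_lt_of_eval_finset_eq Finset.univ ?_ fun x _ => ?_
  · refine (degree_sub_lt_left h_deg (monic_ascPochhammer _ _).ne_zero ?_).trans_eq ?_
    · rw [(monic_ascPochhammer _ _).leadingCoeff, h_monic.leadingCoeff]
    · rw [degree_eq_natDegree (monic_ascPochhammer _ _).ne_zero, ascPochhammer_natDegree,
        Finset.card_univ, ZMod.card]
  · rw [eval_sub, eval_pow, eval_X, ZMod.pow_card, sub_self, ascPochhammer_eval_eq_prod]
    refine Finset.prod_eq_zero (Finset.mem_range.2 (ZMod.val_lt (-x))) ?_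
    rw [ZMod.natCast_val, ZMod.cast_id, add_neg_cancel]

end Pochhammer

section Wilson

variable {R : Type*} [CommRing R] [IsLocalRing R]

theorem eq_one_or_eq_neg_one_of_mul_self_eq_one (h2 : IsUnit (2 : R)) {x : R} (hx : x * x = 1) :
    x = 1 ∨ x = -1 := by
  have h_sum : IsUnit (x + 1 + (1 - x)) := by
    convert h2 using 1
    ring
  have h_prod : (x + 1) * (1 - x) = 0 := by linear_combination -hx
  rcases IsLocalRing.isUnit_or_isUnit_of_isUnit_add h_sum with h | h
  · exact .inl (sub_eq_zero.1 (h.mul_right_eq_zero.1 h_prod)).symm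
  · exact .inr (eq_neg_of_add_eq_zero_left (h.mul_left_eq_zero.1 h_prod))

theorem prod_units_eq_neg_one [Fintype Rˣ] (h2 : IsUnit (2 : R)) : ∏ u : Rˣ, u = -1 := by
  classical
  have h_others : ∏ u ∈ (Finset.univ : Finset Rˣ).erase (-1), u = 1 := by
    refine Finset.prod_involution (fun u _ => u⁻¹) (by simp) (fun u hu hu1 h_inv => ?_)
      (fun u => by simp [inv_eq_iff_eq_inv (a := u)]) (by simp)
    have h_sq : (u : R) * u = 1 := by
      rw [← Units.val_mul, Units.val_eq_one]
      nth_rw 1 [← h_inv]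
      exact inv_mul_cancel u
    rcases eq_one_or_eq_neg_one_of_mul_self_eq_one h2 h_sq with h | h
    · exact hu1 (Units.ext h)
    · exact Finset.ne_of_mem_erase hu (Units.ext h)
  rw [← Finset.mul_prod_erase _ _ (Finset.mem_univ (-1)), h_others, mul_one]

end Wilson

section PadicGamma

variable {p : ℕ} [Fact p.Prime]

theorem prime_dvd_natCast_iff {n : ℕ} : (p : ℤ_[p]) ∣ n ↔ p ∣ n := by
  rw [← PadicInt.norm_lt_one_iff_dvd, PadicInt.norm_natCast_lt_one_iff]

theorem pow_dvd_iff_norm_le {x : ℤ_[p]} {N : ℕ} :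
    (p : ℤ_[p]) ^ N ∣ x ↔ ‖x‖ ≤ (p : ℝ) ^ (-N : ℤ) := by
  rw [PadicInt.norm_le_pow_iff_mem_span_pow, Ideal.mem_span_singleton]

theorem norm_le_norm_of_forall_pow_dvd {x y : ℤ_[p]}
    (h : ∀ N : ℕ, (p : ℤ_[p]) ^ N ∣ x → (p : ℤ_[p]) ^ N ∣ y) : ‖y‖ ≤ ‖x‖ := by
  rcases eq_or_ne x 0 with rfl | hx
  · refine norm_zero.trans_ge (le_of_forall_gt_imp_ge_of_dense fun ε hε => ?_)
    obtain ⟨N, hN⟩ := PadicInt.exists_pow_neg_lt p hε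
    exact (pow_dvd_iff_norm_le.1 (h N (dvd_zero _))).trans hN.le
  · rw [PadicInt.norm_eq_zpow_neg_valuation hx, ← pow_dvd_iff_norm_le]
    exact h _ (pow_dvd_iff_norm_le.2 (PadicInt.norm_eq_zpow_neg_valuation hx).le)

theorem pow_dvd_sub_iff_toZModPow_eq {x y : ℤ_[p]} {N : ℕ} :
    (p : ℤ_[p]) ^ N ∣ x - y ↔ PadicInt.toZModPow N x = PadicInt.toZModPow N y := by
  rw [← sub_eq_zero, ← map_sub, ← RingHom.mem_ker, PadicInt.ker_toZModPow,
    Ideal.mem_span_singleton]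

theorem isUnit_iff_not_prime_dvd {x : ℤ_[p]} : IsUnit x ↔ ¬ (p : ℤ_[p]) ∣ x := by
  rw [← PadicInt.norm_lt_one_iff_dvd, ← PadicInt.not_isUnit_iff, not_not]

/-- `x` if `x` is a `p`-adic unit and `1` otherwise, so that `Γ_p(x + 1) = -unitPart x * Γ_p(x)`. -/
noncomputable def unitPart (x : ℤ_[p]) : ℤ_[p] :=
  open Classical in if (p : ℤ_[p]) ∣ x then 1 else x

theorem unitPart_of_dvd {x : ℤ_[p]} (h : (p : ℤ_[p]) ∣ x) : unitPart x = 1 := if_pos h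

theorem unitPart_of_not_dvd {x : ℤ_[p]} (h : ¬ (p : ℤ_[p]) ∣ x) : unitPart x = x := if_neg h

theorem isUnit_unitPart (x : ℤ_[p]) : IsUnit (unitPart x) := by
  by_cases h : (p : ℤ_[p]) ∣ x
  · rw [unitPart_of_dvd h]
    exact isUnit_one
  · rwa [unitPart_of_not_dvd h, isUnit_iff_not_prime_dvd]

theorem pow_dvd_unitPart_sub {N : ℕ} {x y : ℤ_[p]} (h : (p : ℤ_[p]) ^ N ∣ x - y) :
    (p : ℤ_[p]) ^ N ∣ unitPart x - unitPart y := by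
  rcases eq_or_ne N 0 with rfl | hN
  · simp
  have hxy := dvd_iff_dvd_of_dvd_sub ((dvd_pow_self _ hN).trans h)
  by_cases hx : (p : ℤ_[p]) ∣ x
  · simp [unitPart_of_dvd hx, unitPart_of_dvd (hxy.1 hx)]
  · rwa [unitPart_of_not_dvd hx, unitPart_of_not_dvd (mt hxy.2 hx)]

theorem continuous_unitPart : Continuous (unitPart : ℤ_[p] → ℤ_[p]) :=
  (LipschitzWith.of_dist_le_mul (K := 1) fun x y => by
    rw [NNReal.coe_one, one_mul, dist_eq_norm, dist_eq_norm]
    exact norm_le_norm_of_forall_pow_dvd fun _ => pow_dvd_unitPart_sub).continuous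

theorem padicGammaNat_eq_prod_unitPart (n : ℕ) :
    (padicGammaNat p n : ℤ_[p]) = (-1) ^ n * ∏ j ∈ Finset.range n, unitPart (j : ℤ_[p]) := by
  have h_factor (j : ℕ) :
      ((if ¬ p ∣ j then (j : ℤ) else 1 : ℤ) : ℤ_[p]) = unitPart (j : ℤ_[p]) := by
    by_cases h : p ∣ j
    · simp [h, unitPart_of_dvd (prime_dvd_natCast_iff.2 h)]
    · simp [h, unitPart_of_not_dvd (mt prime_dvd_natCast_iff.1 h)]
  rw [padicGammaNat, Finset.prod_filter, Int.cast_mul, Int.cast_prod]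
  simp only [h_factor]
  cases n with
  | zero => simp
  | succ n =>
    rw [Finset.range_eq_Ico, Finset.prod_eq_prod_Ico_succ_bot n.succ_pos, Nat.cast_zero,
      unitPart_of_dvd (dvd_zero _), one_mul]
    simp

theorem padicGammaNat_succ (n : ℕ) :
    (padicGammaNat p (n + 1) : ℤ_[p]) = -unitPart (n : ℤ_[p]) * padicGammaNat p n := by
  rw [padicGammaNat_eq_prod_unitPart, padicGammaNat_eq_prod_unitPart, Finset.prod_range_succ]
  ring

theorem pow_dvd_prod_unitPart_add_one (hp : p ≠ 2) (N : ℕ) :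
    (p : ℤ_[p]) ^ N ∣ ∏ j ∈ Finset.range (p ^ N), unitPart (j : ℤ_[p]) + 1 := by
  rcases eq_or_ne N 0 with rfl | hN
  · simp
  have hpr : p.Prime := Fact.out
  have : Fact (1 < p ^ N) := ⟨Nat.one_lt_pow hN hpr.one_lt⟩
  have : NeZero (p ^ N) := ⟨(pow_pos hpr.pos N).ne'⟩
  have : IsLocalRing (ZMod (p ^ N)) :=
    .of_surjective' (PadicInt.toZModPow N) (ZMod.ringHom_surjective _)
  have h2 : IsUnit (2 : ZMod (p ^ N)) := by
    have := (ZMod.isUnit_iff_coprime 2 (p ^ N)).2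
      (((Nat.coprime_primes Nat.prime_two hpr).2 hp.symm).pow_right N)
    exact_mod_cast this
  have h_dvd (j : ℕ) : (p : ℤ_[p]) ∣ j ↔ ¬ IsUnit (j : ZMod (p ^ N)) := by
    rw [prime_dvd_natCast_iff, ZMod.isUnit_iff_coprime, Nat.coprime_pow_right_iff (by omega),
      Nat.coprime_comm, hpr.coprime_iff_not_dvd, not_not]
  have h_units : ∏ u : (ZMod (p ^ N))ˣ, (u : ZMod (p ^ N)) =
      ∏ j ∈ Finset.range (p ^ N), PadicInt.toZModPow N (unitPart (j : ℤ_[p])) := by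
    refine Finset.prod_of_injOn (fun u => (u : ZMod (p ^ N)).val)
      (fun u _ v _ h => Units.ext (ZMod.val_injective _ h))
      (fun u _ => by simpa using ZMod.val_lt _) (fun j hj hju => ?_) (fun u _ => ?_)
    · rw [unitPart_of_dvd, map_one]
      rw [h_dvd]
      rintro ⟨u, hu⟩
      refine hju ⟨u, Finset.mem_coe.2 (Finset.mem_univ u), ?_⟩
      simp [hu, ZMod.val_natCast, Nat.mod_eq_of_lt (Finset.mem_range.1 hj)]
    · have hu := (h_dvd (u : ZMod (p ^ N)).val).not.2 (by simp)
      rw [unitPart_of_not_dvd hu, map_natCast, ZMod.natCast_zmod_val]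
  rw [← Ideal.mem_span_singleton, ← PadicInt.ker_toZModPow, RingHom.mem_ker, map_add, map_prod,
    ← h_units, ← Units.coe_prod, prod_units_eq_neg_one h2]
  simp

theorem pow_dvd_padicGammaNat_sub (hp : p ≠ 2) {N m n : ℕ}
    (h : (p : ℤ_[p]) ^ N ∣ (m : ℤ_[p]) - n) :
    (p : ℤ_[p]) ^ N ∣ padicGammaNat p m - padicGammaNat p n := by
  set f : ℕ → ZMod (p ^ N) := fun n => PadicInt.toZModPow N (padicGammaNat p n : ℤ_[p])
  have hf : Function.Periodic f (p ^ N) := fun n => by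
    induction n with
    | zero =>
      have h_wilson := pow_dvd_prod_unitPart_add_one hp N
      rw [← sub_neg_eq_add, pow_dvd_sub_iff_toZModPow_eq] at h_wilson
      simp only [f, padicGammaNat_eq_prod_unitPart, map_mul, zero_add, h_wilson]
      simp [((Fact.out : p.Prime).odd_of_ne_two hp).pow.neg_one_pow]
    | succ n ih =>
      have h_shift := pow_dvd_sub_iff_toZModPow_eq.1 (pow_dvd_unitPart_sub
        (x := ((n + p ^ N : ℕ) : ℤ_[p])) (y := n) (N := N) (by simp))
      simp only [f, Nat.succ_add, Nat.succ_eq_add_one, padicGammaNat_succ, map_mul, map_neg,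
        h_shift] at ih ⊢
      rw [ih]
  have h_mod : m % p ^ N = n % p ^ N := by
    rw [pow_dvd_sub_iff_toZModPow_eq, map_natCast, map_natCast] at h
    exact (ZMod.natCast_eq_natCast_iff _ _ _).1 h
  rw [pow_dvd_sub_iff_toZModPow_eq]
  exact (hf.map_mod_nat m).symm.trans (h_mod ▸ hf.map_mod_nat n)

theorem norm_padicGammaNat_sub_le (hp : p ≠ 2) (m n : ℕ) :
    ‖(padicGammaNat p m - padicGammaNat p n : ℤ_[p])‖ ≤ ‖(m - n : ℤ_[p])‖ :=
  norm_le_norm_of_forall_pow_dvd fun _ => pow_dvd_padicGammaNat_sub hp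

theorem continuous_padicGamma_and_padicGamma_natCast (hp : p ≠ 2) :
    Continuous (padicGamma p) ∧ ∀ n : ℕ, padicGamma p n = padicGammaNat p n := by
  let _ : UniformSpace ℕ := .comap (Nat.cast : ℕ → ℤ_[p]) inferInstance
  have h_ind : IsUniformInducing (Nat.cast : ℕ → ℤ_[p]) := ⟨rfl⟩
  have h_basis := Metric.uniformity_basis_dist_le (α := ℤ_[p])
  have h_unif : UniformContinuous fun n : ℕ => (padicGammaNat p n : ℤ_[p]) := by
    refine ((h_ind.basis_uniformity h_basis).uniformContinuous_iff h_basis).2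
      fun ε hε => ⟨ε, hε, fun m n h => ?_⟩
    simp only [Set.mem_preimage, Prod.map_apply, Set.mem_ofPred_eq, dist_eq_norm] at h ⊢
    exact (norm_padicGammaNat_sub_le hp m n).trans h
  exact ⟨(uniformContinuous_uniformly_extend h_ind PadicInt.denseRange_natCast h_unif).continuous,
    uniformly_extend_of_ind h_ind PadicInt.denseRange_natCast h_unif⟩

theorem continuous_padicGamma (hp : p ≠ 2) : Continuous (padicGamma p) :=
  (continuous_padicGamma_and_padicGamma_natCast hp).1

theorem padicGamma_natCast (hp : p ≠ 2) (n : ℕ) : padicGamma p n = padicGammaNat p n :=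
  (continuous_padicGamma_and_padicGamma_natCast hp).2 n

theorem pow_dvd_padicGamma_sub (hp : p ≠ 2) {N : ℕ} {x y : ℤ_[p]} (h : (p : ℤ_[p]) ^ N ∣ x - y) :
    (p : ℤ_[p]) ^ N ∣ padicGamma p x - padicGamma p y := by
  have h_lip : ‖padicGamma p x - padicGamma p y‖ ≤ ‖x - y‖ := by
    have h_cont := continuous_padicGamma hp
    refine PadicInt.denseRange_natCast.induction_on₂
      (p := fun x y => ‖padicGamma p x - padicGamma p y‖ ≤ ‖x - y‖) ?_
      (fun m n => ?_) x y
    · exact isClosed_le (by fun_prop) (by fun_prop)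
    · simpa only [padicGamma_natCast hp] using norm_padicGammaNat_sub_le hp m n
  rw [pow_dvd_iff_norm_le] at h ⊢
  exact h_lip.trans h

theorem padicGamma_zero (hp : p ≠ 2) : padicGamma p 0 = 1 := by
  simpa [padicGammaNat] using padicGamma_natCast hp 0

theorem padicGamma_add_one (hp : p ≠ 2) (x : ℤ_[p]) :
    padicGamma p (x + 1) = -unitPart x * padicGamma p x := by
  have h_cont := continuous_padicGamma hp
  have h_unit := continuous_unitPart (p := p)
  refine PadicInt.denseRange_natCast.induction_on x (isClosed_eq (by fun_prop) (by fun_prop))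
    fun n => ?_
  rw [← Nat.cast_succ, padicGamma_natCast hp, padicGamma_natCast hp, padicGammaNat_succ]

theorem padicGamma_add_natCast (hp : p ≠ 2) (x : ℤ_[p]) (n : ℕ) :
    padicGamma p (x + n) =
      (-1) ^ n * (∏ j ∈ Finset.range n, unitPart (x + (j : ℤ_[p]))) * padicGamma p x := by
  induction n with
  | zero => simp
  | succ n ih =>
    rw [Nat.cast_succ, ← add_assoc, padicGamma_add_one hp, ih, Finset.prod_range_succ]
    ring

theorem isUnit_padicGamma (hp : p ≠ 2) (x : ℤ_[p]) : IsUnit (padicGamma p x) := by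
  have h_nat : IsUnit (padicGamma p (x.zmodRepr : ℤ_[p])) := by
    have h := padicGamma_add_natCast hp 0 x.zmodRepr
    rw [zero_add, padicGamma_zero hp, mul_one] at h
    rw [h]
    exact (isUnit_one.neg.pow _).mul (IsUnit.prod_iff.2 fun j _ => isUnit_unitPart _)
  have h_congr := pow_dvd_padicGamma_sub hp (N := 1) (x := x) (y := x.zmodRepr) (by
    rw [pow_one, ← PadicInt.norm_lt_one_iff_dvd]
    exact PadicInt.norm_sub_zmodRepr_lt_one x)
  rw [isUnit_iff_not_prime_dvd] at h_nat ⊢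
  rwa [dvd_iff_dvd_of_dvd_sub (pow_one (p : ℤ_[p]) ▸ h_congr)]

end PadicGamma

section Wolstenholme

open Polynomial

variable {p : ℕ} [Fact p.Prime]

theorem prime_dvd_coeff_two_ascPochhammer_comp (h5 : 5 ≤ p) :
    (p : ℤ_[p]) ∣ ((ascPochhammer ℤ_[p] (p - 1)).comp (X + 1)).coeff 2 := by
  have h_succ : X * (ascPochhammer ℤ_[p] (p - 1)).comp (X + 1) = ascPochhammer ℤ_[p] p := by
    rw [← ascPochhammer_succ_left, Nat.sub_add_cancel (by omega)]
  rw [← coeff_X_mul, h_succ, ← Ideal.mem_span_singleton, ← PadicInt.maximalIdeal_eq_span_p,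
    ← PadicInt.ker_toZMod, RingHom.mem_ker, ← coeff_map, ascPochhammer_map,
    ascPochhammer_zmod_prime, coeff_sub, coeff_X_pow, coeff_X]
  simp [show 3 ≠ p by omega]

theorem pow_dvd_ascPochhammer_eval_sub_factorial (hp : p ≠ 2) {N : ℕ}
    (hN : N = 2 ∨ N = 3 ∧ 5 ≤ p) {x : ℤ_[p]} (hx : (p : ℤ_[p]) ∣ x) :
    (p : ℤ_[p]) ^ N ∣ (ascPochhammer ℤ_[p] (p - 1)).eval (x + 1) - (p - 1).factorial := by
  set P : ℤ_[p][X] := (ascPochhammer ℤ_[p] (p - 1)).comp (X + 1)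
  have hpr : p.Prime := Fact.out
  have h_eval (t : ℤ_[p]) : P.eval t = (ascPochhammer ℤ_[p] (p - 1)).eval (t + 1) := by
    simp [P, eval_comp]
  have h_zero : P.eval 0 = (p - 1).factorial := by rw [h_eval, zero_add, ascPochhammer_eval_one]
  have h_neg : P.eval (-(p : ℤ_[p])) = P.eval 0 := by
    have h_even := (hpr.odd_of_ne_two hp).tsub_odd odd_one
    rw [h_eval, h_zero, show -(p : ℤ_[p]) + 1 = -((p - 1 : ℕ) : ℤ_[p]) by
      rw [Nat.cast_pred hpr.pos]; ring, ascPochhammer_eval_neg_natCast_self, h_even.neg_one_pow,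
      one_mul]
  have h_taylor (t : ℤ_[p]) : P.eval t - P.eval 0 = t * (P.coeff 1 + t * P.divX.divX.eval t) := by
    rw [eval_eq_coeff_zero_add_mul_eval_divX, eval_eq_coeff_zero_add_mul_eval_divX P.divX,
      ← coeff_zero_eq_eval_zero, coeff_divX]
    ring
  -- The symmetry `P(-p) = P(0)` determines the linear coefficient of `P`.
  have h_lin : P.coeff 1 = p * P.divX.divX.eval (-(p : ℤ_[p])) := by
    have h_mul := h_taylor (-(p : ℤ_[p]))
    rw [h_neg, sub_self, eq_comm, mul_eq_zero, neg_eq_zero] at h_mul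
    linear_combination h_mul.resolve_left (Nat.cast_ne_zero.2 hpr.ne_zero)
  rw [← h_eval, ← h_zero, h_taylor, h_lin]
  rcases hN with rfl | ⟨rfl, h5⟩
  · rw [pow_two]
    exact mul_dvd_mul hx (dvd_add (dvd_mul_right _ _) (hx.mul_right _))
  · have h_quad {t : ℤ_[p]} (ht : (p : ℤ_[p]) ∣ t) : (p : ℤ_[p]) ∣ P.divX.divX.eval t := by
      have h_coeff : (p : ℤ_[p]) ∣ P.coeff 2 := prime_dvd_coeff_two_ascPochhammer_comp h5
      rw [eval_eq_coeff_zero_add_mul_eval_divX, coeff_divX, coeff_divX]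
      exact dvd_add h_coeff (ht.mul_right _)
    rw [pow_succ', pow_two]
    exact mul_dvd_mul hx (dvd_add (mul_dvd_mul_left _ (h_quad (dvd_neg.2 (dvd_refl (p : ℤ_[p])))))
      (mul_dvd_mul hx (h_quad hx)))

end Wolstenholme

section Multiplicativity

variable {p : ℕ} [Fact p.Prime]

theorem prod_unitPart_eq_ascPochhammer {n : ℕ} {y : ℤ_[p]}
    (hy : ∀ j < n, ¬ (p : ℤ_[p]) ∣ y + j) :
    ∏ j ∈ Finset.range n, unitPart (y + (j : ℤ_[p])) = (ascPochhammer ℤ_[p] n).eval y := by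
  rw [ascPochhammer_eval_eq_prod]
  exact Finset.prod_congr rfl fun j hj => unitPart_of_not_dvd (hy j (Finset.mem_range.1 hj))

theorem prime_dvd_add_one_add_iff {x : ℤ_[p]} (hx : (p : ℤ_[p]) ∣ x) (j : ℕ) :
    (p : ℤ_[p]) ∣ x + 1 + j ↔ p ∣ j + 1 := by
  rw [← prime_dvd_natCast_iff, add_assoc, dvd_add_right hx, add_comm, Nat.cast_succ]

theorem prod_unitPart_add_one_of_lt {x : ℤ_[p]} (hx : (p : ℤ_[p]) ∣ x) {n : ℕ} (hn : n < p) :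
    ∏ j ∈ Finset.range n, unitPart (x + 1 + (j : ℤ_[p])) =
      (ascPochhammer ℤ_[p] n).eval (x + 1) :=
  prod_unitPart_eq_ascPochhammer fun j hj => by
    rw [prime_dvd_add_one_add_iff hx]
    exact Nat.not_dvd_of_pos_of_lt j.succ_pos (by omega)

theorem padicGamma_add_one_add_natCast (hp : p ≠ 2) {x : ℤ_[p]} (hx : (p : ℤ_[p]) ∣ x) (n : ℕ) :
    padicGamma p (x + 1 + n) = (-1) ^ (n + 1) *
      (∏ j ∈ Finset.range n, unitPart (x + 1 + (j : ℤ_[p]))) * padicGamma p x := by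
  rw [padicGamma_add_natCast hp, padicGamma_add_one hp, unitPart_of_dvd hx]
  ring

theorem padicGamma_add_prime (hp : p ≠ 2) {x : ℤ_[p]} (hx : (p : ℤ_[p]) ∣ x) :
    padicGamma p (x + p) =
      -(ascPochhammer ℤ_[p] (p - 1)).eval (x + 1) * padicGamma p x := by
  have hpr : p.Prime := Fact.out
  rw [← prod_unitPart_add_one_of_lt hx (Nat.sub_lt hpr.pos one_pos),
    show x + p = x + 1 + (p - 1 : ℕ) by rw [Nat.cast_pred hpr.pos]; ring,
    padicGamma_add_one_add_natCast hp hx, Nat.sub_add_cancel hpr.one_le,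
    (hpr.odd_of_ne_two hp).neg_one_pow, neg_one_mul]

theorem pow_dvd_padicGamma_prime_mul_natCast_sub (hp : p ≠ 2) {N : ℕ}
    (hN : N = 2 ∨ N = 3 ∧ 5 ≤ p) (m : ℕ) :
    (p : ℤ_[p]) ^ N ∣ padicGamma p (p * m) - (-((p - 1).factorial : ℤ_[p])) ^ m := by
  induction m with
  | zero => simp [padicGamma_zero hp]
  | succ m ih =>
    rw [Nat.cast_succ, mul_add, mul_one, padicGamma_add_prime hp (dvd_mul_right _ _), pow_succ']
    refine dvd_mul_sub_mul ?_ ih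
    rw [neg_sub_neg, ← dvd_neg, neg_sub]
    exact pow_dvd_ascPochhammer_eval_sub_factorial hp hN (dvd_mul_right _ _)

theorem pow_dvd_padicGamma_add_sub_mul (hp : p ≠ 2) {N : ℕ} (hN : N = 2 ∨ N = 3 ∧ 5 ≤ p)
    {x y : ℤ_[p]} (hx : (p : ℤ_[p]) ∣ x) (hy : (p : ℤ_[p]) ∣ y) :
    (p : ℤ_[p]) ^ N ∣ padicGamma p (x + y) - padicGamma p x * padicGamma p y := by
  have h_cont := continuous_padicGamma hp
  obtain ⟨x, rfl⟩ := hx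
  obtain ⟨y, rfl⟩ := hy
  rw [pow_dvd_iff_norm_le]
  refine PadicInt.denseRange_natCast.induction_on₂ (p := fun x y =>
    ‖padicGamma p (p * x + p * y) - padicGamma p (p * x) * padicGamma p (p * y)‖ ≤
      (p : ℝ) ^ (-N : ℤ)) (isClosed_le (by fun_prop) (by fun_prop)) (fun m n => ?_) x y
  have h_factorial := pow_dvd_padicGamma_prime_mul_natCast_sub hp hN
  have h_add := h_factorial (m + n)
  rw [Nat.cast_add, mul_add, pow_add] at h_add
  rw [← pow_dvd_iff_norm_le]
  simpa using dvd_sub h_add (dvd_mul_sub_mul (h_factorial m) (h_factorial n))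

theorem pow_dvd_padicGamma_neg_two_mul_sub (hp : p ≠ 2) {N : ℕ} (hN : N = 2 ∨ N = 3 ∧ 5 ≤ p)
    {x : ℤ_[p]} (hx : (p : ℤ_[p]) ∣ x) :
    (p : ℤ_[p]) ^ N ∣
      padicGamma p (-2 * x) - padicGamma p x * padicGamma p (-x) ^ 3 := by
  have h_double := pow_dvd_padicGamma_add_sub_mul hp hN (dvd_neg.2 hx) (dvd_neg.2 hx)
  have h_inv := pow_dvd_padicGamma_add_sub_mul hp hN hx (dvd_neg.2 hx)
  rw [add_neg_cancel, padicGamma_zero hp] at h_inv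
  convert dvd_add h_double (h_inv.mul_left (padicGamma p (-x) ^ 2)) using 1
  ring_nf

end Multiplicativity

section WellPoised

variable {K : Type*} [Field K]

/-- The factor `(A)_k (b)_k (c)_k (d)_k / (k! (1 + A - b)_k (1 + A - c)_k (1 + A - d)_k)` of the
`k`-th term `(1 + 2k / A) * wellPoisedTerm A b c d k` of a very well-poised `₅F₄` series. -/
noncomputable def wellPoisedTerm (A b c d : K) (k : ℕ) : K :=
  (ascPochhammer K k).eval A * (ascPochhammer K k).eval b *
    (ascPochhammer K k).eval c * (ascPochhammer K k).eval d /
    (k.factorial * (ascPochhammer K k).eval (1 + A - b) *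
      (ascPochhammer K k).eval (1 + A - c) * (ascPochhammer K k).eval (1 + A - d))

theorem wellPoisedTerm_zero (A b c d : K) : wellPoisedTerm A b c d 0 = 1 := by
  simp [wellPoisedTerm]

theorem wellPoisedTerm_succ (A b c d : K) (k : ℕ) :
    wellPoisedTerm A b c d (k + 1) = wellPoisedTerm A b c d k *
      ((A + k) * (b + k) * (c + k) * (d + k) /
        ((k + 1) * (1 + A - b + k) * (1 + A - c + k) * (1 + A - d + k))) := by
  simp only [wellPoisedTerm, ascPochhammer_succ_eval, Nat.factorial_succ, Nat.cast_mul,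
    Nat.cast_succ, div_mul_div_comm]
  ring_nf

theorem wellPoisedTerm_add_one_add_one {A b c : K} (d : K) {k : ℕ}
    (hb : ∀ i < k + 1, 1 + A - b + i ≠ 0) (hc : ∀ i < k + 1, 1 + A - c + i ≠ 0) :
    A * d * wellPoisedTerm (A + 1) b c (d + 1) k * ((1 + A - b + k) * (1 + A - c + k)) =
      (A + k) * (d + k) * ((1 + A - b) * (1 + A - c)) * wellPoisedTerm A b c d k := by
  have h_ratio {x : K} (hx : ∀ i < k + 1, 1 + A - x + i ≠ 0) :
      (1 + A - x + k) / (ascPochhammer K k).eval (1 + (A + 1) - x) =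
        (1 + A - x) / (ascPochhammer K k).eval (1 + A - x) := by
    have h_shift := mul_ascPochhammer_eval_add_one k (1 + A - x)
    have h_ne := ascPochhammer_eval_ne_zero hx
    rw [ascPochhammer_succ_eval_left] at h_ne
    rw [show 1 + (A + 1) - x = 1 + A - x + 1 by ring, div_eq_div_iff (right_ne_zero_of_mul h_ne)
      (ascPochhammer_eval_ne_zero fun i hi => hx i (hi.trans k.lt_succ_self)), h_shift, mul_comm]
  rw [wellPoisedTerm, wellPoisedTerm, show 1 + (A + 1) - (d + 1) = 1 + A - d by ring]
  calc
    _ = (A * (ascPochhammer K k).eval (A + 1)) * (d * (ascPochhammer K k).eval (d + 1)) *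
          (ascPochhammer K k).eval b * (ascPochhammer K k).eval c *
          ((1 + A - b + k) / (ascPochhammer K k).eval (1 + (A + 1) - b)) *
          ((1 + A - c + k) / (ascPochhammer K k).eval (1 + (A + 1) - c)) /
          (k.factorial * (ascPochhammer K k).eval (1 + A - d)) := by ring
    _ = _ := by
      rw [mul_ascPochhammer_eval_add_one, mul_ascPochhammer_eval_add_one, h_ratio hb, h_ratio hc]
      ring

theorem sum_wellPoisedTerm_sub [CharZero K] {A b c d : K} {n : ℕ}
    (hb : ∀ i < n, 1 + A - b + i ≠ 0) (hc : ∀ i < n, 1 + A - c + i ≠ 0)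
    (hd : ∀ i < n, 1 + A - d + i ≠ 0) :
    d * ∑ k ∈ Finset.range n,
      ((1 + A - b) * (1 + A - c) * ((A + 2 * k) * wellPoisedTerm A b c d k) -
        A * (1 + A - b - c) * ((A + 1 + 2 * k) * wellPoisedTerm (A + 1) b c (d + 1) k)) =
      n * (A - d + n) * (1 + A - b) * (1 + A - c) * wellPoisedTerm A b c d n := by
  induction n with
  | zero => simp
  | succ n ih =>
    have h_shift := wellPoisedTerm_add_one_add_one d hb hc
    have hb' := hb n n.lt_succ_self
    have hc' := hc n n.lt_succ_self
    have hd' := hd n n.lt_succ_self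
    have hn : (n + 1 : K) ≠ 0 := n.cast_add_one_ne_zero
    rw [Finset.sum_range_succ, mul_add, ih (fun i hi => hb i (hi.trans n.lt_succ_self))
      (fun i hi => hc i (hi.trans n.lt_succ_self)) (fun i hi => hd i (hi.trans n.lt_succ_self)),
      wellPoisedTerm_succ, Nat.cast_succ]
    rw [← eq_div_iff (mul_ne_zero hb' hc')] at h_shift
    calc
      _ = (A + n) * (d + n) * (1 + A - b) * (1 + A - c) * wellPoisedTerm A b c d n -
          (1 + A - b - c) * (A + 1 + 2 * n) *
            (A * d * wellPoisedTerm (A + 1) b c (d + 1) n) := by ring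
      _ = _ := by
        rw [h_shift]
        field_simp
        ring

theorem sum_wellPoisedTerm_succ [CharZero K] {A b c : K} {n : ℕ}
    (hA : ∀ i < n + 1, 1 + A + (n + 1 : ℕ) + i ≠ 0) (hb : ∀ i < n + 1, 1 + A - b + i ≠ 0)
    (hc : ∀ i < n + 1, 1 + A - c + i ≠ 0) :
    (1 + A - b) * (1 + A - c) * ∑ k ∈ Finset.range (n + 1 + 1),
      (A + 2 * k) * wellPoisedTerm A b c (-(n + 1 : ℕ)) k =
    A * (1 + A - b - c) * ∑ k ∈ Finset.range (n + 1),
      (A + 1 + 2 * k) * wellPoisedTerm (A + 1) b c (-n) k := by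
  have h_telescope := sum_wellPoisedTerm_sub (d := -((n + 1 : ℕ) : K)) hb hc
    (fun i hi => by rw [sub_neg_eq_add]; exact hA i hi)
  rw [Finset.sum_sub_distrib, ← Finset.mul_sum, ← Finset.mul_sum,
    show -((n + 1 : ℕ) : K) + 1 = -n by push_cast; ring] at h_telescope
  rw [Finset.sum_range_succ]
  push_cast at h_telescope ⊢
  refine mul_left_cancel₀ (n.cast_add_one_ne_zero : (n + 1 : K) ≠ 0) ?_
  linear_combination -h_telescope

theorem sum_wellPoisedTerm [CharZero K] {A b c : K} {n : ℕ} (hA : ∀ i < n, 1 + A + n + i ≠ 0)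
    (hb : ∀ i < n, 1 + A - b + i ≠ 0) (hc : ∀ i < n, 1 + A - c + i ≠ 0) :
    (∑ k ∈ Finset.range (n + 1), (A + 2 * k) * wellPoisedTerm A b c (-n) k) *
      ((ascPochhammer K n).eval (1 + A - b) * (ascPochhammer K n).eval (1 + A - c)) =
      A * (ascPochhammer K n).eval (1 + A) * (ascPochhammer K n).eval (1 + A - b - c) := by
  induction n generalizing A with
  | zero => simp [wellPoisedTerm_zero]
  | succ n ih =>
    have h_shift {x : K} (h : ∀ i < n + 1, 1 + A - x + i ≠ 0) (i : ℕ) (hi : i < n) :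
        1 + (A + 1) - x + i ≠ 0 := by
      convert h (i + 1) (by omega) using 1
      push_cast
      ring
    have h_ih := ih (fun i hi => by convert hA i (by omega) using 1; push_cast; ring)
      (h_shift hb) (h_shift hc)
    rw [← add_assoc, add_sub_right_comm _ 1 b, add_sub_right_comm _ 1 c,
      add_sub_right_comm _ 1 c] at h_ih
    simp only [ascPochhammer_succ_eval_left]
    linear_combination
      (ascPochhammer K n).eval (1 + A - b + 1) * (ascPochhammer K n).eval (1 + A - c + 1) *
        sum_wellPoisedTerm_succ hA hb hc + A * (1 + A - b - c) * h_ih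

end WellPoised

section PochhammerRatio

open Polynomial

variable {R : Type*} [CommRing R]

/-- The quotient `(x)_k / (y)_k`, with the junk value `0` unless `(y)_k` is a unit. -/
noncomputable def pochRatio (x y : R) (k : ℕ) : R :=
  (ascPochhammer R k).eval x * Ring.inverse ((ascPochhammer R k).eval y)

theorem pochRatio_mul {x y : R} {k : ℕ} (h : IsUnit ((ascPochhammer R k).eval y)) :
    pochRatio x y k * (ascPochhammer R k).eval y = (ascPochhammer R k).eval x := by
  rw [pochRatio, mul_assoc, Ring.inverse_mul_cancel _ h, mul_one]

theorem map_ascPochhammer_eval {S : Type*} [CommRing S] (f : R →+* S) (k : ℕ) (x : R) :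
    f ((ascPochhammer R k).eval x) = (ascPochhammer S k).eval (f x) := by
  rw [← ascPochhammer_map f, eval_map_apply]

theorem map_pochRatio {K : Type*} [Field K] (f : R →+* K) {x y : R} {k : ℕ}
    (h : IsUnit ((ascPochhammer R k).eval y)) :
    f (pochRatio x y k) = (ascPochhammer K k).eval (f x) / (ascPochhammer K k).eval (f y) := by
  rw [← map_ascPochhammer_eval, ← map_ascPochhammer_eval, eq_div_iff (h.map f).ne_zero, ← map_mul,
    pochRatio_mul h]

theorem add_natCast_dvd_pochRatio (x y : R) {i k : ℕ} (h : i < k) : x + i ∣ pochRatio x y k := by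
  rw [pochRatio, ascPochhammer_eval_eq_prod]
  exact (Finset.dvd_prod_of_mem _ (Finset.mem_range.2 h)).mul_right _

end PochhammerRatio

section Symmetry

open Polynomial

variable {R : Type*} [CommRing R]

theorem sq_dvd_eval_mul_eval_neg_sub (F : R[X]) (t : R) :
    t ^ 2 ∣ F.eval t * F.eval (-t) - F.eval 0 ^ 2 := by
  rw [eval_eq_coeff_zero_add_mul_eval_divX F t, eval_eq_coeff_zero_add_mul_eval_divX F (-t),
    ← coeff_zero_eq_eval_zero]
  obtain ⟨r, hr⟩ := sub_dvd_eval_sub t (-t) F.divX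
  refine ⟨2 * F.coeff 0 * r - F.divX.eval t * F.divX.eval (-t), ?_⟩
  linear_combination F.coeff 0 * t * hr

theorem sq_dvd_eval_sub_of_eval_neg_eq (h2 : IsUnit (2 : R)) {F : R[X]} {t : R}
    (hF : F.eval (-t) = F.eval t) : t ^ 2 ∣ F.eval t - F.eval 0 := by
  obtain ⟨r, hr⟩ := sub_dvd_eval_sub t (-t) F.divX
  rw [← h2.dvd_mul_left]
  refine ⟨2 * r, ?_⟩
  rw [eval_eq_coeff_zero_add_mul_eval_divX F t, eval_eq_coeff_zero_add_mul_eval_divX F (-t)] at hF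
  rw [eval_eq_coeff_zero_add_mul_eval_divX F t, ← coeff_zero_eq_eval_zero]
  linear_combination -hF + t * hr

/-- The polynomial `(X - a)_k (1 + X)_k`. Its value at `s` divided by `k! (1 + s)_k` is
`(s - a)_k / k!`, and its value at `0` divided by `k! (1 + s)_k` is `(-a)_k / (1 + s)_k`. -/
noncomputable def reflectPoch (R : Type*) [CommRing R] (a k : ℕ) : R[X] :=
  (ascPochhammer R k).comp (X - (a : R[X])) * (ascPochhammer R k).comp (X + 1)

theorem reflectPoch_eval (a k : ℕ) (t : R) :
    (reflectPoch R a k).eval t =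
      (ascPochhammer R k).eval (t - a) * (ascPochhammer R k).eval (t + 1) := by
  simp [reflectPoch, eval_comp]

theorem reflectPoch_eval_mul_eval_neg (j k : ℕ) (t : R) :
    (reflectPoch R (j + k) j).eval t * (reflectPoch R (j + k) k).eval (-t) =
      (reflectPoch R (j + k) (j + k)).eval t := by
  have h_sign : ((-1 : R) ^ k) * (-1) ^ k = 1 := by rw [← mul_pow, neg_one_mul, neg_neg, one_pow]
  have h_left : (ascPochhammer R k).eval (-t - (j + k : ℕ)) =
      (-1) ^ k * (ascPochhammer R k).eval (t + 1 + j) := by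
    rw [← neg_add', ascPochhammer_eval_neg]
    push_cast
    ring_nf
  have h_right : (ascPochhammer R k).eval (-t + 1) =
      (-1) ^ k * (ascPochhammer R k).eval (t - (j + k : ℕ) + j) := by
    rw [← neg_sub, neg_add_eq_sub, neg_sub, ← neg_sub t 1, ascPochhammer_eval_neg]
    push_cast
    ring_nf
  simp only [reflectPoch_eval, ascPochhammer_add_eval, h_left, h_right]
  linear_combination (ascPochhammer R j).eval (t - (j + k : ℕ)) *
    (ascPochhammer R j).eval (t + 1) * (ascPochhammer R k).eval (t + 1 + j) *
    (ascPochhammer R k).eval (t - (j + k : ℕ) + j) * h_sign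

theorem sq_dvd_reflectPoch_eval_sub (h2 : IsUnit (2 : R)) {j k : ℕ}
    (hk : IsUnit ((reflectPoch R (j + k) k).eval 0)) (t : R) :
    t ^ 2 ∣ (reflectPoch R (j + k) j).eval t * (reflectPoch R (j + k) k).eval 0 -
      (reflectPoch R (j + k) k).eval t * (reflectPoch R (j + k) j).eval 0 := by
  have h_even : (reflectPoch R (j + k) (j + k)).eval (-t) =
      (reflectPoch R (j + k) (j + k)).eval t := by
    simpa [reflectPoch_eval] using reflectPoch_eval_mul_eval_neg 0 (j + k) t
  have h_prod := reflectPoch_eval_mul_eval_neg j k t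
  have h_prod_zero := reflectPoch_eval_mul_eval_neg (R := R) j k 0
  rw [neg_zero] at h_prod_zero
  obtain ⟨u, hu⟩ := sq_dvd_eval_sub_of_eval_neg_eq h2 h_even
  obtain ⟨v, hv⟩ := sq_dvd_eval_mul_eval_neg_sub (reflectPoch R (j + k) k) t
  rw [← hk.dvd_mul_left]
  refine ⟨(reflectPoch R (j + k) k).eval t * u - (reflectPoch R (j + k) j).eval t * v, ?_⟩
  linear_combination (reflectPoch R (j + k) k).eval t * (hu + h_prod - h_prod_zero) -
    (reflectPoch R (j + k) j).eval t * hv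

end Symmetry

section TaylorExpansion

open Polynomial

variable {R : Type*} [CommRing R]

theorem eval_mul_of_pow_three_eq_zero (F : R[X]) {t : R} (ht : t ^ 3 = 0) (c : R) :
    F.eval (c * t) = F.coeff 0 + F.coeff 1 * (c * t) + F.coeff 2 * (c * t) ^ 2 := by
  rw [eval_eq_coeff_zero_add_mul_eval_divX, eval_eq_coeff_zero_add_mul_eval_divX F.divX,
    eval_eq_coeff_zero_add_mul_eval_divX F.divX.divX, coeff_divX, coeff_divX, coeff_divX]
  linear_combination c ^ 3 * F.divX.divX.divX.eval (c * t) * ht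

theorem interpolation_of_pow_three_eq_zero (F G : R[X]) (hF : IsUnit (F.eval 0)) {t : R}
    (ht : t ^ 3 = 0) :
    (3 * G.eval (-t) * F.eval t ^ 2 - 3 * G.eval 0 * F.eval 0 * F.eval t +
      G.eval t * F.eval 0 ^ 2) * F.eval (-t) ^ 3 =
      G.eval (-2 * t) * F.eval (-2 * t) * F.eval t ^ 2 * F.eval 0 ^ 2 := by
  have h_pos (H : R[X]) := eval_mul_of_pow_three_eq_zero H ht 1
  have h_neg (H : R[X]) := eval_mul_of_pow_three_eq_zero H ht (-1)
  have h_two (H : R[X]) := eval_mul_of_pow_three_eq_zero H ht (-2)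
  have h_zero (H : R[X]) : H.eval 0 = H.coeff 0 := (coeff_zero_eq_eval_zero H).symm
  simp only [one_mul, neg_one_mul] at h_pos h_neg
  have h_F : F.eval t * F.eval (-t) ^ 3 = F.eval (-2 * t) * F.eval 0 ^ 3 := by
    rw [h_pos, h_neg, h_two, h_zero]
    grind
  have h_G : 3 * G.eval (-t) * F.eval t ^ 2 * F.eval 0 - 3 * G.eval 0 * F.eval 0 ^ 2 * F.eval t +
      G.eval t * F.eval 0 ^ 3 = G.eval (-2 * t) * F.eval t ^ 3 := by
    rw [h_pos, h_pos, h_neg, h_two, h_zero, h_zero]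
    grind
  refine hF.mul_left_cancel ?_
  linear_combination F.eval (-t) ^ 3 * h_G + G.eval (-2 * t) * F.eval t ^ 2 * h_F

theorem pow_three_dvd_interpolation_sub (F G : R[X]) (hF : IsUnit (F.eval 0)) (t : R) :
    t ^ 3 ∣ (3 * G.eval (-t) * F.eval t ^ 2 - 3 * G.eval 0 * F.eval 0 * F.eval t +
      G.eval t * F.eval 0 ^ 2) * F.eval (-t) ^ 3 -
      G.eval (-2 * t) * F.eval (-2 * t) * F.eval t ^ 2 * F.eval 0 ^ 2 := by
  rw [← Ideal.mem_span_singleton, ← Ideal.Quotient.mk_eq_mk_iff_sub_mem]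
  generalize hf : Ideal.Quotient.mk (Ideal.span {t ^ 3}) = f
  have h_map (H : R[X]) (x : R) : f (H.eval x) = (H.map f).eval (f x) := (eval_map_apply f x).symm
  have ht : f t ^ 3 = 0 := by rw [← hf, ← map_pow, Ideal.Quotient.mk_singleton_self]
  have hF' : IsUnit ((F.map f).eval 0) := by rw [← map_zero f, ← h_map]; exact hF.map f
  simpa only [h_map, map_add, map_sub, map_mul, map_pow, map_neg, map_zero, map_ofNat] using
    interpolation_of_pow_three_eq_zero (F.map f) (G.map f) hF' ht

end TaylorExpansion

section PairedTerms

open Polynomial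

variable {R : Type*} [CommRing R]

theorem isUnit_ascPochhammer_eval_of_le {x : R} {k n : ℕ} (hkn : k ≤ n)
    (h : IsUnit ((ascPochhammer R n).eval x)) : IsUnit ((ascPochhammer R k).eval x) := by
  rw [← Nat.add_sub_cancel' hkn, ascPochhammer_add_eval] at h
  exact isUnit_of_mul_isUnit_left h

theorem isUnit_ascPochhammer_eval_neg_natCast_self {n : ℕ}
    (h : IsUnit ((ascPochhammer R n).eval 1)) : IsUnit ((ascPochhammer R n).eval (-(n : R))) := by
  rw [ascPochhammer_eval_one] at h
  rw [ascPochhammer_eval_neg_natCast_self]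
  exact (isUnit_one.neg.pow n).mul h

theorem pochRatio_mul_eq_reflectPoch_eval {a k : ℕ} {t : R}
    (h₀ : IsUnit ((ascPochhammer R k).eval 1)) :
    pochRatio (t - a) 1 k * ((ascPochhammer R k).eval 1 * (ascPochhammer R k).eval (t + 1)) =
      (reflectPoch R a k).eval t := by
  rw [← mul_assoc, pochRatio_mul h₀, reflectPoch_eval]

theorem pochRatio_neg_mul_eq_reflectPoch_eval_zero {a k : ℕ} {t : R}
    (ht : IsUnit ((ascPochhammer R k).eval (t + 1))) :
    pochRatio (-a : R) (t + 1) k * ((ascPochhammer R k).eval 1 * (ascPochhammer R k).eval (t + 1)) =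
      (reflectPoch R a k).eval 0 := by
  rw [mul_left_comm, pochRatio_mul ht, reflectPoch_eval, zero_sub, zero_add, mul_comm]

theorem dvd_pochRatio_sub {a k : ℕ} {t : R} (h₀ : IsUnit ((ascPochhammer R k).eval 1))
    (ht : IsUnit ((ascPochhammer R k).eval (t + 1))) :
    t ∣ pochRatio (t - a) 1 k - pochRatio (-a : R) (t + 1) k := by
  rw [← (h₀.mul ht).dvd_mul_right, sub_mul, pochRatio_mul_eq_reflectPoch_eval h₀,
    pochRatio_neg_mul_eq_reflectPoch_eval_zero ht]
  simpa only [sub_zero] using sub_dvd_eval_sub t 0 (reflectPoch R a k)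

theorem dvd_pochRatio_neg_sub_choose {a k : ℕ} {t : R}
    (ht : IsUnit ((ascPochhammer R k).eval (t + 1))) :
    t ∣ pochRatio (-a : R) (t + 1) k - (-1) ^ k * (a.choose k : R) := by
  have h_choose : (ascPochhammer R k).eval (-(a : R)) =
      (-1) ^ k * (a.choose k : R) * (ascPochhammer R k).eval 1 := by
    rw [ascPochhammer_eval_neg_eq_descPochhammer, descPochhammer_eval_eq_descFactorial,
      Nat.descFactorial_eq_factorial_mul_choose, ascPochhammer_eval_one]
    push_cast
    ring
  have h_dvd := sub_dvd_eval_sub 1 (t + 1) (ascPochhammer R k)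
  rw [sub_add_cancel_right, neg_dvd] at h_dvd
  rw [← ht.dvd_mul_right, sub_mul, pochRatio_mul ht, h_choose, ← mul_sub]
  exact h_dvd.mul_left _

theorem dvd_pochRatio_neg_pow_four_sub {j k : ℕ} {t : R}
    (ht : IsUnit ((ascPochhammer R (j + k)).eval (t + 1))) :
    t ∣ pochRatio (-(j + k : ℕ) : R) (t + 1) j ^ 4 -
      pochRatio (-(j + k : ℕ) : R) (t + 1) k ^ 4 := by
  have h_pow {i : ℕ} (hi : i ≤ j + k) :
      t ∣ pochRatio (-(j + k : ℕ) : R) (t + 1) i ^ 4 - ((j + k).choose i : R) ^ 4 := by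
    have h_sign : ((-1 : R) ^ i) ^ 4 = 1 := by
      rw [← pow_mul, mul_comm, pow_mul, (by decide : Even 4).neg_one_pow, one_pow]
    simpa only [mul_pow, h_sign, one_mul] using
      (dvd_pochRatio_neg_sub_choose (isUnit_ascPochhammer_eval_of_le hi ht)).trans
        (sub_dvd_pow_sub_pow _ _ 4)
  have h_j := h_pow (Nat.le_add_right j k)
  have h_k := h_pow (Nat.le_add_left k j)
  rw [← Nat.choose_symm_add] at h_k
  simpa only [sub_sub_sub_cancel_right] using dvd_sub h_j h_k

theorem sq_dvd_pochRatio_sub_mul_sub (h2 : IsUnit (2 : R)) {j k : ℕ} {t : R}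
    (h₀ : IsUnit ((ascPochhammer R (j + k)).eval 1))
    (ht : IsUnit ((ascPochhammer R (j + k)).eval (t + 1))) :
    t ^ 2 ∣ pochRatio (t - (j + k : ℕ)) 1 j * pochRatio (-(j + k : ℕ) : R) (t + 1) k -
      pochRatio (t - (j + k : ℕ)) 1 k * pochRatio (-(j + k : ℕ) : R) (t + 1) j := by
  have hj := Nat.le_add_right j k
  have hk := Nat.le_add_left k j
  have hj₀ := isUnit_ascPochhammer_eval_of_le hj h₀
  have hk₀ := isUnit_ascPochhammer_eval_of_le hk h₀
  have hjt := isUnit_ascPochhammer_eval_of_le hj ht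
  have hkt := isUnit_ascPochhammer_eval_of_le hk ht
  have h_unit : IsUnit ((reflectPoch R (j + k) k).eval 0) := by
    rw [reflectPoch_eval, zero_sub, zero_add]
    exact (isUnit_ascPochhammer_eval_of_le hk <|
      isUnit_ascPochhammer_eval_neg_natCast_self h₀).mul hk₀
  have h := sq_dvd_reflectPoch_eval_sub h2 h_unit t
  rw [← pochRatio_mul_eq_reflectPoch_eval (t := t) hj₀,
    ← pochRatio_mul_eq_reflectPoch_eval (t := t) hk₀,
    ← pochRatio_neg_mul_eq_reflectPoch_eval_zero hjt,
    ← pochRatio_neg_mul_eq_reflectPoch_eval_zero hkt] at h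
  rw [← ((hj₀.mul hjt).mul (hk₀.mul hkt)).dvd_mul_right]
  convert h using 1
  ring

theorem pow_four_dvd_add_of_dvd_sub {j k : ℕ} {t x y x' y' : R} (hy : IsUnit y) (hy' : IsUnit y')
    (h : t ∣ x - y) (h' : t ∣ x' - y') (h_sq : t ^ 2 ∣ x * y' - x' * y)
    (h_pow : t ∣ y ^ 4 - y' ^ 4) :
    t ^ 4 ∣ (t + j - k) * (x * (x - y) ^ 3) + (t + k - j) * (x' * (x' - y') ^ 3) := by
  rw [← ((hy.mul hy').pow 3).dvd_mul_right]
  have h_cube : t ^ 4 ∣ ((x - y) * y') ^ 3 - ((x' - y') * y) ^ 3 := by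
    obtain ⟨u, hu⟩ := h
    obtain ⟨u', hu'⟩ := h'
    obtain ⟨w, hw⟩ := h_sq
    refine ⟨w * ((u * y') ^ 2 + u * y' * (u' * y) + (u' * y) ^ 2), ?_⟩
    rw [hu, hu']
    linear_combination (t ^ 2 * ((u * y') ^ 2 + u * y' * (u' * y) + (u' * y) ^ 2)) *
      (hw - y' * hu + y * hu')
  have h_bracket : t ∣ (t + j - k) * (x * y ^ 3) + (t + k - j) * (x' * y' ^ 3) := by
    obtain ⟨u, hu⟩ := h
    obtain ⟨u', hu'⟩ := h'
    obtain ⟨w, hw⟩ := h_pow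
    refine ⟨x * y ^ 3 + x' * y' ^ 3 + (j - k) * (w + u * y ^ 3 - u' * y' ^ 3), ?_⟩
    linear_combination (j - k) * (hw + y ^ 3 * hu - y' ^ 3 * hu')
  have h_mul : t ^ 4 ∣ ((x' - y') * y) ^ 3 *
      ((t + j - k) * (x * y ^ 3) + (t + k - j) * (x' * y' ^ 3)) := by
    rw [pow_succ]
    exact mul_dvd_mul (pow_dvd_pow_of_dvd (h'.mul_right y) 3) h_bracket
  convert dvd_add (h_cube.mul_left ((t + j - k) * (x * y ^ 3))) h_mul using 1
  ring

theorem pow_four_dvd_sum_mul_cube (h2 : IsUnit (2 : R)) {a : ℕ} {t : R}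
    (h₀ : IsUnit ((ascPochhammer R a).eval 1)) (ht : IsUnit ((ascPochhammer R a).eval (t + 1))) :
    t ^ 4 ∣ ∑ k ∈ Finset.range (a + 1), (t - a + 2 * k) *
      (pochRatio (t - a) 1 k * (pochRatio (t - a) 1 k - pochRatio (-a : R) (t + 1) k) ^ 3) := by
  set T : ℕ → R := fun k => (t - a + 2 * k) *
    (pochRatio (t - a) 1 k * (pochRatio (t - a) 1 k - pochRatio (-a : R) (t + 1) k) ^ 3)
  have h_pair {j k : ℕ} (h : j + k = a) : t ^ 4 ∣ T j + T k := by
    subst h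
    have hj := Nat.le_add_right j k
    have hk := Nat.le_add_left k j
    have h_unit {i : ℕ} (hi : i ≤ j + k) : IsUnit (pochRatio (-(j + k : ℕ) : R) (t + 1) i) := by
      refine isUnit_of_mul_isUnit_left (y := (ascPochhammer R i).eval (t + 1)) ?_
      rw [pochRatio_mul (isUnit_ascPochhammer_eval_of_le hi ht)]
      exact isUnit_ascPochhammer_eval_of_le hi <|
        isUnit_ascPochhammer_eval_neg_natCast_self h₀
    have h_dvd {i : ℕ} (hi : i ≤ j + k) := dvd_pochRatio_sub (a := j + k)
      (isUnit_ascPochhammer_eval_of_le hi h₀) (isUnit_ascPochhammer_eval_of_le hi ht)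
    convert pow_four_dvd_add_of_dvd_sub (j := j) (k := k) (h_unit hj) (h_unit hk) (h_dvd hj)
      (h_dvd hk) (sq_dvd_pochRatio_sub_mul_sub h2 h₀ ht) (dvd_pochRatio_neg_pow_four_sub ht)
      using 1
    simp only [T]
    push_cast
    ring
  rw [← h2.dvd_mul_left, two_mul]
  nth_rw 2 [← Finset.sum_range_reflect]
  rw [← Finset.sum_add_distrib]
  refine Finset.dvd_sum fun k hk => h_pair ?_
  have := Finset.mem_range.1 hk
  omega

end PairedTerms

section TruncatedSum

open Polynomial

variable {R : Type*} [CommRing R] [IsDomain R] [CharZero R]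

theorem sum_pochRatio {A b c : R} {n : ℕ} (hb : IsUnit ((ascPochhammer R n).eval (1 + A - b)))
    (hc : IsUnit ((ascPochhammer R n).eval (1 + A - c)))
    (hn : IsUnit ((ascPochhammer R n).eval (1 + A + n)))
    (h₀ : IsUnit ((ascPochhammer R n).eval 1)) :
    (∑ k ∈ Finset.range (n + 1), (A + 2 * k) * (pochRatio A 1 k * pochRatio b (1 + A - b) k *
      pochRatio c (1 + A - c) k * pochRatio (-n : R) (1 + A + n) k)) *
      ((ascPochhammer R n).eval (1 + A - b) * (ascPochhammer R n).eval (1 + A - c)) =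
      A * (ascPochhammer R n).eval (1 + A) * (ascPochhammer R n).eval (1 + A - b - c) := by
  set f := algebraMap R (FractionRing R)
  have h_ne {x : R} (hx : IsUnit ((ascPochhammer R n).eval x)) (i : ℕ) (hi : i < n) :
      f x + i ≠ 0 := by
    rw [ascPochhammer_eval_eq_prod, IsUnit.prod_iff] at hx
    simpa using ((hx i (Finset.mem_range.2 hi)).map f).ne_zero
  have h_term (k : ℕ) (hk : k ∈ Finset.range (n + 1)) :
      f ((A + 2 * k) * (pochRatio A 1 k * pochRatio b (1 + A - b) k *
        pochRatio c (1 + A - c) k * pochRatio (-n : R) (1 + A + n) k)) =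
        (f A + 2 * k) * wellPoisedTerm (f A) (f b) (f c) (-n) k := by
    have h_unit {x : R} := isUnit_ascPochhammer_eval_of_le (x := x)
      (Nat.lt_succ_iff.1 (Finset.mem_range.1 hk))
    rw [map_mul, map_mul, map_mul, map_mul,
      map_pochRatio f (h_unit h₀), map_pochRatio f (h_unit hb),
      map_pochRatio f (h_unit hc), map_pochRatio f (h_unit hn), wellPoisedTerm]
    simp [div_mul_div_comm, map_ofNat f]
  have h_sum := sum_wellPoisedTerm (A := f A) (b := f b) (c := f c) (n := n)
    (by simpa using h_ne hn) (by simpa using h_ne hb) (by simpa using h_ne hc)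
  have h_inj : Function.Injective f := IsFractionRing.injective R (FractionRing R)
  apply h_inj
  rw [map_mul, map_sum, Finset.sum_congr rfl h_term]
  simpa [map_ascPochhammer_eval] using h_sum

theorem sum_pow_four_sub_mul_cube {a : ℕ} {t : R} (h₀ : IsUnit ((ascPochhammer R a).eval 1))
    (ht : IsUnit ((ascPochhammer R a).eval (t + 1))) :
    (∑ k ∈ Finset.range (a + 1), (t - a + 2 * k) * pochRatio (t - a) 1 k ^ 4 -
      ∑ k ∈ Finset.range (a + 1), (t - a + 2 * k) *
        (pochRatio (t - a) 1 k * (pochRatio (t - a) 1 k - pochRatio (-a : R) (t + 1) k) ^ 3)) *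
      ((ascPochhammer R a).eval 1 ^ 2 * (ascPochhammer R a).eval (t + 1) ^ 2) =
      t * (ascPochhammer R a).eval (t - a) *
        (3 * (ascPochhammer R a).eval (-t + 1 + a) * (ascPochhammer R a).eval (t + 1) ^ 2 -
        3 * (ascPochhammer R a).eval (1 + a : R) * (ascPochhammer R a).eval 1 *
          (ascPochhammer R a).eval (t + 1) +
        (ascPochhammer R a).eval (t + 1 + a) * (ascPochhammer R a).eval 1 ^ 2) := by
  have h_prefactor : (t - a) * (ascPochhammer R a).eval (1 + (t - a)) =
      t * (ascPochhammer R a).eval (t - a) := by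
    rw [add_comm 1, mul_ascPochhammer_eval_add_one, sub_add_cancel, mul_comm]
  have h_self : 1 + (t - a) - (t - a) = 1 := by ring
  have h_neg : 1 + (t - a) - -a = t + 1 := by ring
  have h_nat : 1 + (t - a) + a = t + 1 := by ring
  have h_three := sum_pochRatio (A := t - a) (b := t - a) (c := t - a) (n := a)
    (by rwa [h_self]) (by rwa [h_self]) (by rwa [h_nat]) h₀
  have h_two := sum_pochRatio (A := t - a) (b := t - a) (c := -a) (n := a)
    (by rwa [h_self]) (by rwa [h_neg]) (by rwa [h_nat]) h₀
  have h_one := sum_pochRatio (A := t - a) (b := -a) (c := -a) (n := a)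
    (by rwa [h_neg]) (by rwa [h_neg]) (by rwa [h_nat]) h₀
  simp only [h_prefactor, h_self, h_neg, h_nat] at h_three h_two h_one
  rw [show 1 - (t - a) = -t + 1 + a by ring] at h_three
  rw [show (1 : R) - -a = 1 + a by ring] at h_two
  rw [show t + 1 - -a = t + 1 + a by ring] at h_one
  have h_cube (A x y : R) : A * x ^ 4 - A * (x * (x - y) ^ 3) =
      3 * (A * (x * x * x * y)) - 3 * (A * (x * x * y * y)) + A * (x * y * y * y) := by ring
  simp only [← Finset.sum_sub_distrib, h_cube]
  simp only [Finset.sum_add_distrib, Finset.sum_sub_distrib, ← Finset.mul_sum]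
  linear_combination 3 * (ascPochhammer R a).eval (t + 1) ^ 2 * h_three -
    3 * (ascPochhammer R a).eval 1 * (ascPochhammer R a).eval (t + 1) * h_two +
    (ascPochhammer R a).eval 1 ^ 2 * h_one

theorem pow_four_dvd_sum_mul_sub (h2 : IsUnit (2 : R)) {a : ℕ} {t : R}
    (h₀ : IsUnit ((ascPochhammer R a).eval 1)) (ht : IsUnit ((ascPochhammer R a).eval (t + 1))) :
    t ^ 4 ∣ (∑ k ∈ Finset.range (a + 1), (t - a + 2 * k) * pochRatio (t - a) 1 k ^ 4) *
      (ascPochhammer R a).eval (-t + 1) ^ 3 -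
      t * (ascPochhammer R a).eval (t - a) * (ascPochhammer R (a + a)).eval (-2 * t + 1) := by
  have h_cubes := pow_four_dvd_sum_mul_cube h2 h₀ ht
  have h_sums := sum_pow_four_sub_mul_cube h₀ ht
  have h_interpolation := pow_three_dvd_interpolation_sub ((ascPochhammer R a).comp (X + 1))
    ((ascPochhammer R a).comp (X + 1 + (a : R[X]))) (by simpa [eval_comp] using h₀) t
  simp only [eval_comp, eval_add, eval_X, eval_one, eval_natCast, zero_add] at h_interpolation
  obtain ⟨u, hu⟩ := h_cubes
  obtain ⟨v, hv⟩ := h_interpolation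
  rw [← ((h₀.pow 2).mul (ht.pow 2)).dvd_mul_right, ascPochhammer_add_eval]
  refine ⟨u * (ascPochhammer R a).eval 1 ^ 2 * (ascPochhammer R a).eval (t + 1) ^ 2 *
    (ascPochhammer R a).eval (-t + 1) ^ 3 + (ascPochhammer R a).eval (t - a) * v, ?_⟩
  linear_combination (ascPochhammer R a).eval (-t + 1) ^ 3 * h_sums +
    t * (ascPochhammer R a).eval (t - a) * hv +
    (ascPochhammer R a).eval 1 ^ 2 * (ascPochhammer R a).eval (t + 1) ^ 2 *
    (ascPochhammer R a).eval (-t + 1) ^ 3 * hu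

end TruncatedSum

section PadicCongruence

open Polynomial

variable {p : ℕ} [Fact p.Prime]

theorem isUnit_ascPochhammer_eval_add_one {s : ℤ_[p]} (hs : (p : ℤ_[p]) ∣ s) {n : ℕ}
    (hn : n < p) : IsUnit ((ascPochhammer ℤ_[p] n).eval (s + 1)) := by
  rw [← prod_unitPart_add_one_of_lt hs hn]
  exact IsUnit.prod_iff.2 fun j _ => isUnit_unitPart _

theorem pow_four_dvd_sum_range_prime_mul_sub (hp : p ≠ 2) {a : ℕ} (ha : a < p) {s : ℤ_[p]}
    (hs : (p : ℤ_[p]) ∣ s) :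
    (p : ℤ_[p]) ^ 4 ∣ (∑ k ∈ Finset.range p, (s - a + 2 * k) * pochRatio (s - a) 1 k ^ 4) *
      (ascPochhammer ℤ_[p] a).eval (-s + 1) ^ 3 -
      s * (ascPochhammer ℤ_[p] a).eval (s - a) *
        (ascPochhammer ℤ_[p] (2 * a)).eval (-2 * s + 1) := by
  have h2 : IsUnit (2 : ℤ_[p]) := by
    rw [isUnit_iff_not_prime_dvd]
    exact_mod_cast prime_dvd_natCast_iff.not.2 fun h =>
      hp ((Nat.prime_dvd_prime_iff_eq Fact.out Nat.prime_two).1 h)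
  have h₀ : IsUnit ((ascPochhammer ℤ_[p] a).eval 1) := by
    simpa only [zero_add] using isUnit_ascPochhammer_eval_add_one (dvd_zero _) ha
  have h_head := (pow_dvd_pow_of_dvd hs 4).trans <|
    pow_four_dvd_sum_mul_sub h2 h₀ (isUnit_ascPochhammer_eval_add_one hs ha)
  have h_tail : (p : ℤ_[p]) ^ 4 ∣ ∑ k ∈ Finset.Ico (a + 1) p,
      (s - a + 2 * k) * pochRatio (s - a) 1 k ^ 4 := by
    refine Finset.dvd_sum fun k hk => (pow_dvd_pow_of_dvd (hs.trans ?_) 4).mul_left _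
    simpa only [sub_add_cancel] using
      add_natCast_dvd_pochRatio (s - a) 1 (Nat.succ_le_iff.1 (Finset.mem_Ico.1 hk).1)
  rw [← Finset.sum_range_add_sum_Ico _ ha, add_mul, add_sub_right_comm, two_mul]
  exact dvd_add h_head (h_tail.mul_right _)

theorem prod_unitPart_add_one_of_le {x : ℤ_[p]} (hx : (p : ℤ_[p]) ∣ x) {n : ℕ} (hn : p ≤ n)
    (hn' : n < 2 * p) :
    ((p : ℤ_[p]) + x) * ∏ j ∈ Finset.range n, unitPart (x + 1 + (j : ℤ_[p])) =
      (ascPochhammer ℤ_[p] n).eval (x + 1) := by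
  have hp_pos : 0 < p := (Fact.out : p.Prime).pos
  have h_mem : p - 1 ∈ Finset.range n := Finset.mem_range.2 (by omega)
  rw [ascPochhammer_eval_eq_prod, ← Finset.mul_prod_erase _ _ h_mem,
    ← Finset.mul_prod_erase _ _ h_mem,
    unitPart_of_dvd ((prime_dvd_add_one_add_iff hx _).2 (by rw [Nat.sub_add_cancel hp_pos])),
    one_mul, Nat.cast_pred hp_pos]
  congr 1
  · ring
  · refine Finset.prod_congr rfl fun j hj => unitPart_of_not_dvd ?_
    rw [Finset.mem_erase, Finset.mem_range] at hj
    rw [prime_dvd_add_one_add_iff hx]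
    rintro ⟨c, hc⟩
    have hc_lt : c < 2 := by
      by_contra! h
      have := Nat.mul_le_mul_left p h
      omega
    interval_cases c <;> omega

theorem isUnit_ascPochhammer_eval_sub {s : ℤ_[p]} (hs : (p : ℤ_[p]) ∣ s) {a : ℕ} (ha : a < p) :
    IsUnit ((ascPochhammer ℤ_[p] a).eval (s - a)) := by
  rw [← neg_sub, ascPochhammer_eval_neg]
  convert (isUnit_one.neg.pow a).mul
    (isUnit_ascPochhammer_eval_add_one ((dvd_neg).2 hs) ha) using 3
  ring

theorem padicGamma_eq_of_prime_dvd (hp : p ≠ 2) {s : ℤ_[p]} (hs : (p : ℤ_[p]) ∣ s) {a : ℕ}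
    (ha : a < p) :
    padicGamma p s =
      (-1) ^ a * (ascPochhammer ℤ_[p] a).eval (s - a) * padicGamma p (s - a) := by
  have h_unit := isUnit_ascPochhammer_eval_sub hs ha
  rw [ascPochhammer_eval_eq_prod, IsUnit.prod_iff] at h_unit
  have h := padicGamma_add_natCast hp (s - a) a
  rwa [sub_add_cancel, prod_unitPart_eq_ascPochhammer fun j hj =>
    isUnit_iff_not_prime_dvd.1 (h_unit j (Finset.mem_range.2 hj))] at h

theorem pow_four_dvd_sum_mul_padicGamma_add (hp : p ≠ 2) {a : ℕ} (ha : a < p) {s m : ℤ_[p]}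
    (hs : (p : ℤ_[p]) ∣ s) (hα : IsUnit (s - a))
    (hm : m * ∏ j ∈ Finset.range (2 * a), unitPart (-2 * s + 1 + (j : ℤ_[p])) =
      (ascPochhammer ℤ_[p] (2 * a)).eval (-2 * s + 1))
    (hΓ : (p : ℤ_[p]) ^ 3 ∣
      m * (padicGamma p (-2 * s) - padicGamma p s * padicGamma p (-s) ^ 3)) :
    (p : ℤ_[p]) ^ 4 ∣ (∑ k ∈ Finset.range p, (s - a + 2 * k) * pochRatio (s - a) 1 k ^ 4) *
      (padicGamma p (1 + (s - a)) * padicGamma p (1 - (s - a)) ^ 3) +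
      (s - a) * s * m * padicGamma p (1 - 2 * (s - a)) := by
  have h_plus : padicGamma p (1 + (s - a)) = -(s - a) * padicGamma p (s - a) := by
    rw [add_comm, padicGamma_add_one hp, unitPart_of_not_dvd (isUnit_iff_not_prime_dvd.1 hα)]
  have h_minus : padicGamma p (1 - (s - a)) =
      (-1) ^ (a + 1) * (ascPochhammer ℤ_[p] a).eval (-s + 1) * padicGamma p (-s) := by
    rw [← prod_unitPart_add_one_of_lt ((dvd_neg).2 hs) ha,
      ← padicGamma_add_one_add_natCast hp ((dvd_neg).2 hs)]
    congr 1
    ring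
  have h_double : padicGamma p (1 - 2 * (s - a)) =
      -(∏ j ∈ Finset.range (2 * a), unitPart (-2 * s + 1 + (j : ℤ_[p]))) *
        padicGamma p (-2 * s) := by
    have h := padicGamma_add_one_add_natCast hp (hs.mul_left (-2)) (2 * a)
    rw [pow_succ, pow_mul, neg_one_sq, one_pow, one_mul, neg_one_mul] at h
    rw [← h]
    congr 1
    push_cast
    ring
  have h_reflect := padicGamma_eq_of_prime_dvd hp hs ha
  have h_sign : ((-1 : ℤ_[p]) ^ a) ^ 2 = 1 := by
    rw [← pow_mul, mul_comm, pow_mul, neg_one_sq, one_pow]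
  have h_sum := pow_four_dvd_sum_range_prime_mul_sub hp ha hs
  rw [← hm] at h_sum
  rw [← (isUnit_ascPochhammer_eval_sub hs ha).dvd_mul_left, h_plus, h_minus, h_double]
  generalize (∑ k ∈ Finset.range p, (s - a + 2 * k) * pochRatio (s - a) 1 k ^ 4) = S at *
  generalize ∏ j ∈ Finset.range (2 * a), unitPart (-2 * s + 1 + (j : ℤ_[p])) = M at *
  generalize (ascPochhammer ℤ_[p] a).eval (s - a) = C at *
  generalize (ascPochhammer ℤ_[p] a).eval (-s + 1) = E at *
  obtain ⟨u, hu⟩ := h_sum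
  obtain ⟨v, hv⟩ := mul_dvd_mul hs hΓ
  refine ⟨(s - a) * (padicGamma p s * padicGamma p (-s) ^ 3 * u - C * M * v), ?_⟩
  linear_combination (s - a) * (S * E ^ 3 * padicGamma p (-s) ^ 3 *
    (C * padicGamma p (s - a) * (-1) ^ a * h_sign - h_reflect) +
    padicGamma p s * padicGamma p (-s) ^ 3 * hu - C * M * hv)

theorem padicCongr_div_of_pow_dvd_sub {n : ℕ} {x y u : ℤ_[p]} (hu : IsUnit u)
    (h : (p : ℤ_[p]) ^ n ∣ x - y) : PadicCongr p n (x / u) (y / u) := by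
  obtain ⟨u, rfl⟩ := hu
  obtain ⟨z, hz⟩ := h
  refine ⟨z * (u⁻¹ : ℤ_[p]ˣ), ?_⟩
  have h_inv : ((u : ℤ_[p]) : ℚ_[p]) * ((u⁻¹ : ℤ_[p]ˣ) : ℤ_[p]) = 1 := by
    rw [← PadicInt.coe_mul, u.mul_inv, PadicInt.coe_one]
  have h_sub : (x : ℚ_[p]) - y = p ^ n * z := by
    rw [← PadicInt.coe_sub, hz, PadicInt.coe_mul, PadicInt.coe_pow, PadicInt.coe_natCast]
  rw [← sub_div, div_eq_iff (PadicInt.coe_ne_zero.2 u.ne_zero), h_sub, PadicInt.coe_mul]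
  linear_combination -p ^ n * z * h_inv

theorem wellPoised5F4_eq_sum_pochRatio {α : ℤ_[p]} (hα : α ≠ 0) :
    wellPoised5F4 p α (p - 1) =
      (∑ k ∈ Finset.range p, (α + 2 * k) * pochRatio α 1 k ^ 4 : ℤ_[p]) / α := by
  have hα' : (α : ℚ_[p]) ≠ 0 := PadicInt.coe_ne_zero.2 hα
  rw [wellPoised5F4_eq_sum p _ _ hα', Nat.sub_add_cancel (Fact.out : p.Prime).one_le,
    PadicInt.coe_sum, Finset.sum_div]
  refine Finset.sum_congr rfl fun k hk => ?_
  have h_unit := isUnit_ascPochhammer_eval_add_one (dvd_zero _) (Finset.mem_range.1 hk)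
  rw [zero_add] at h_unit
  have h_ratio : ((pochRatio α 1 k : ℤ_[p]) : ℚ_[p]) =
      (ascPochhammer ℚ_[p] k).eval (α : ℚ_[p]) / k.factorial := by
    rw [← ascPochhammer_eval_one]
    exact map_pochRatio PadicInt.Coe.ringHom h_unit
  rw [PadicInt.coe_mul, PadicInt.coe_pow, h_ratio, mul_div_right_comm, PadicInt.coe_add,
    PadicInt.coe_mul, PadicInt.coe_natCast]
  rfl

theorem prime_dvd_add_zmodRepr_neg (α : ℤ_[p]) :
    (p : ℤ_[p]) ∣ α + ((-α).zmodRepr : ℤ_[p]) := by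
  rw [← PadicInt.norm_lt_one_iff_dvd, ← norm_neg, neg_add']
  exact PadicInt.norm_sub_zmodRepr_lt_one _

theorem prime_mul_padicDash (α : ℤ_[p]) :
    (p : ℚ_[p]) * padicDash p α = (α + (-α).zmodRepr : ℤ_[p]) := by
  have hp₀ : (p : ℚ_[p]) ≠ 0 := Nat.cast_ne_zero.2 (Fact.out : p.Prime).ne_zero
  rw [padicDash, mul_div_cancel₀ _ hp₀, PadicInt.coe_add, PadicInt.coe_natCast]

theorem padicCongr_wellPoised5F4 (hp : p ≠ 2) {α m s : ℤ_[p]} (hα : IsUnit α)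
    (hs : s = α + (-α).zmodRepr)
    (hm : m * ∏ j ∈ Finset.range (2 * (-α).zmodRepr), unitPart (-2 * s + 1 + (j : ℤ_[p])) =
      (ascPochhammer ℤ_[p] (2 * (-α).zmodRepr)).eval (-2 * s + 1))
    (hΓ : (p : ℤ_[p]) ^ 3 ∣
      m * (padicGamma p (-2 * s) - padicGamma p s * padicGamma p (-s) ^ 3)) :
    PadicCongr p 4 (wellPoised5F4 p α (p - 1))
      (-(s * m * (padicGamma p (1 - 2 * α) /
        (padicGamma p (1 + α) * padicGamma p (1 - α) ^ 3)))) := by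
  have hαs : s - (-α).zmodRepr = α := by rw [hs, add_sub_cancel_right]
  have h_dvd := pow_four_dvd_sum_mul_padicGamma_add hp (PadicInt.zmodRepr_lt_p (-α))
    (hs ▸ prime_dvd_add_zmodRepr_neg α) (hαs.symm ▸ hα) hm hΓ
  rw [hαs, ← sub_neg_eq_add] at h_dvd
  have hu := (isUnit_padicGamma hp (1 + α)).mul ((isUnit_padicGamma hp (1 - α)).pow 3)
  have hα₀ : (α : ℚ_[p]) ≠ 0 := PadicInt.coe_ne_zero.2 hα.ne_zero
  have hu₀ := PadicInt.coe_ne_zero.2 hu.ne_zero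
  have h_congr := padicCongr_div_of_pow_dvd_sub (hα.mul hu) h_dvd
  rw [PadicInt.coe_mul, PadicInt.coe_mul α, mul_div_mul_right _ _ hu₀,
    ← wellPoised5F4_eq_sum_pochRatio hα.ne_zero] at h_congr
  convert h_congr using 1
  rw [PadicInt.coe_mul, PadicInt.coe_pow] at hu₀ ⊢
  push_cast
  field_simp

end PadicCongruence

theorem theorem9p3 (p : ℕ) [Fact p.Prime] (hp : p ≠ 2) (α : ℤ_[p]) (hα : IsUnit α) :
    (((p : ℚ) + 1) / 2 ≤ ((-α).zmodRepr : ℚ) →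
      PadicCongr p 4 (wellPoised5F4 p (α : ℚ_[p]) (p - 1))
        (-((p : ℚ_[p]) ^ 2 * padicDash p α * (1 - 2 * padicDash p α) *
          ((padicGamma p (1 - 2 * α) : ℚ_[p]) /
            ((padicGamma p (1 + α) : ℚ_[p]) * (padicGamma p (1 - α) : ℚ_[p]) ^ 3))))) ∧
    (5 ≤ p → ((-α).zmodRepr : ℚ) ≤ ((p : ℚ) - 1) / 2 →
      PadicCongr p 4 (wellPoised5F4 p (α : ℚ_[p]) (p - 1))
        (-((p : ℚ_[p]) * padicDash p α *
          ((padicGamma p (1 - 2 * α) : ℚ_[p]) /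
            ((padicGamma p (1 + α) : ℚ_[p]) * (padicGamma p (1 - α) : ℚ_[p]) ^ 3))))) := by
  have hs := prime_dvd_add_zmodRepr_neg α
  have hs₂ : (p : ℤ_[p]) ∣ -2 * (α + (-α).zmodRepr) := hs.mul_left (-2)
  have ha := PadicInt.zmodRepr_lt_p (-α)
  refine ⟨fun h => ?_, fun h5 h => ?_⟩
  · have h_le : p ≤ 2 * (-α).zmodRepr := by
      have : (p : ℚ) ≤ 2 * (-α).zmodRepr := by linarith
      exact_mod_cast this
    have h_dvd := mul_dvd_mul (dvd_add dvd_rfl hs₂)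
      (pow_dvd_padicGamma_neg_two_mul_sub hp (Or.inl rfl) hs)
    convert padicCongr_wellPoised5F4 hp hα rfl
      (prod_unitPart_add_one_of_le hs₂ h_le (by omega)) ((pow_succ' _ 2).dvd.trans h_dvd) using 3
    have h_coe : ((-2 : ℤ_[p]) : ℚ_[p]) = -2 := rfl
    rw [← prime_mul_padicDash, PadicInt.coe_add, PadicInt.coe_mul, ← prime_mul_padicDash, h_coe,
      PadicInt.coe_natCast]
    ring
  · have h_lt : 2 * (-α).zmodRepr < p := by
      have : (2 * (-α).zmodRepr : ℚ) < p := by linarith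
      exact_mod_cast this
    convert padicCongr_wellPoised5F4 (m := 1) hp hα rfl
      (by rw [one_mul, prod_unitPart_add_one_of_lt hs₂ h_lt])
      ((pow_dvd_padicGamma_neg_two_mul_sub hp (Or.inr ⟨rfl, h5⟩) hs).mul_left 1) using 3
    rw [PadicInt.coe_one, mul_one, prime_mul_padicDash]
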